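/- Let $T,\theta,\sigma>0$ and $\mu,a_0\in\mathbb R$. On a probability space $(\Omega,\mathcal A,P)$ let $B$ be a standard Brownian motion on $[0,T]$ and let $a$ be the Ornstein–Uhlenbeck process $$da(t)=\theta(\mu-a(t))\,dt+\sigma\,dB(t),\qquad a(0)=a_0,$$ i.e. almost surely $a$ has continuous paths and $a(t)=a_0+\int_0^t\theta(\mu-a(s))\,ds+\sigma B(t)$ for all $t\in[0,T]$. Let $u_0\in L^2(\mathbb R)$ and consider the random transport equation $$u_t+(a(t,\omega)u)_x=0,\qquad u(x,0)=u_0(x),\qquad (x,t)\in\mathbb R\times[0,T].$$ A pathwise weak solution is a random field $u(x,t,\omega)$, for each $t\in[0,T]$ measurable in $(x,\omega)$ up to null sets, such that for $P$-a.e. $\omega$ we have $u(\cdot,\cdot,\omega)\in C([0,T],L^2(\mathbb R))$ and $$\int_0^T\!\!\int_{\mathbb R}\big(u\,\varphi_t+a\,u\,\varphi_x\big)\,dx\,dt+\int_{\mathbb R}u_0(x)\varphi(x,0)\,dx=0\quad\text{for all }\varphi\in C^1_c(\mathbb R\times[0,T)).$$ Put $$\hat m_t=\mu t-(a_0-\mu)\frac{e^{-\theta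 t}-1}{\theta},\qquad \hat\sigma_t^2=\frac{\sigma^2}{\theta^3}\Big(\theta t+2e^{-\theta t}-\tfrac12e^{-2\theta t}-\tfrac32\Big),\qquad f_{m,v}(y)=\frac1{\sqrt{2\pi v}}\,e^{-(y-m)^2/(2v)}.$$ Then: 1. For every $t\in(0,T]$, $\hat\sigma_t^2>0$ and $\int_0^t a(s)\,ds\sim\mathcal N(\hat m_t,\hat\sigma_t^2)$. 2. The field $u_0\big(x-\int_0^t a(s,\omega)\,ds\big)$ is a pathwise weak solution, and every pathwise weak solution $u$ coincides with it: for $P$-a.e. $\omega$ and all $t\in[0,T]$, $u(x,t,\omega)=u_0\big(x-\int_0^ta(s,\omega)\,ds\big)$ for a.e. $x$. 3. For every pathwise weak solution $u$, every $t\in(0,T]$ and a.e. $x\in\mathbb R$, $u(x,t)$ is integrable and $$\mathbb E[u(x,t)]=\int_{\mathbb R}u_0(x-y)\,f_{\hat m_t,\hat\sigma_t^2}(y)\,dy=\big(f_{0,\hat\sigma_t^2}*u_0\big)(x-\hat m_t).$$ Moreover, for every integer $m\ge0$ with $m\le2$ or $u_0\in L^m(\mathbb R)$, $u(x,t)^m$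 is integrable and $\mathbb E[u(x,t)^m]=\int_{\mathbb R}u_0(x-y)^m f_{\hat m_t,\hat\sigma_t^2}(y)\,dy$. For the solution $u_0\big(x-\int_0^ta(s)\,ds\big)$ all this holds for every $x\in\mathbb R$, and the first integral on the right converges absolutely. -/

import Mathlib

open MeasureTheory ProbabilityTheory Set Filter Topology
open scoped Convolution

/-- `B` is a standard Brownian motion on the time interval `[0, T]`: it starts in zero, has
continuous paths, and has independent increments `B t - B s ∼ N(0, t - s)`.
(Values of `B` at times outside `[0, T]` are irrelevant.) -/
structure IsBrownianOn {Ω : Type*} [MeasurableSpace Ω] (T : ℝ) (B : ℝ → Ω → ℝ)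
    (P : Measure Ω) : Prop where
  zero : ∀ᵐ ω ∂P, B 0 ω = 0
  cont : ∀ᵐ ω ∂P, ContinuousOn (fun t ↦ B t ω) (Icc 0 T)
  indep : HasIndepIncrements (fun (t : Icc (0 : ℝ) T) ↦ B t) P
  law : ∀ s t : ℝ, 0 ≤ s → s ≤ t → t ≤ T →
    HasLaw (fun ω ↦ B t ω - B s ω) (gaussianReal 0 (t - s).toNNReal) P

/-- `a` solves the Ornstein–Uhlenbeck equation
`da(t) = θ (μ - a(t)) dt + σ dB(t)`, `a(0) = a₀`, on `[0, T]`: almost surely its path is continuous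
and satisfies the integrated equation for all times. The stochastic integral of the constant `σ`
over `[0, t]` is `σ (B t - B 0)`. -/
structure IsOrnsteinUhlenbeck {Ω : Type*} [MeasurableSpace Ω] (T θ μ σ a₀ : ℝ)
    (B a : ℝ → Ω → ℝ) (P : Measure Ω) : Prop where
  cont : ∀ᵐ ω ∂P, ContinuousOn (fun t ↦ a t ω) (Icc 0 T)
  eqn : ∀ᵐ ω ∂P, ∀ t ∈ Icc (0 : ℝ) T,
    a t ω = a₀ + (∫ s in (0 : ℝ)..t, θ * (μ - a s ω)) + σ * (B t ω - B 0 ω)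

/-- Test functions: (restrictions to `ℝ × [0, T)` of) `C¹` functions `φ(x, t)` on `ℝ × ℝ` with
compact support contained in `ℝ × (-∞, T)`. They need not vanish at the initial time. -/
structure IsTestFunction (T : ℝ) (φ : ℝ → ℝ → ℝ) : Prop where
  contDiff : ContDiff ℝ 1 (Function.uncurry φ)
  compact : HasCompactSupport (Function.uncurry φ)
  supp : tsupport (Function.uncurry φ) ⊆ {p : ℝ × ℝ | p.2 < T}

/-- `v(x, t)` is a weak solution on `ℝ × [0, T]`, in the class `C([0, T], L²(ℝ))`, of
`v_t + (b(t) v)_x = 0`, `v(x, 0) = u₀(x)`. -/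
structure IsWeakSolution (T : ℝ) (b : ℝ → ℝ) (u₀ : ℝ → ℝ) (v : ℝ → ℝ → ℝ) : Prop where
  memLp : ∀ t ∈ Icc (0 : ℝ) T, MemLp (fun x ↦ v x t) 2 volume
  cont : ∀ t ∈ Icc (0 : ℝ) T,
    Tendsto (fun s ↦ eLpNorm (fun x ↦ v x s - v x t) 2 volume) (𝓝[Icc 0 T] t) (𝓝 0)
  weak : ∀ φ : ℝ → ℝ → ℝ, IsTestFunction T φ →
    (∫ t in (0 : ℝ)..T, ∫ x : ℝ,
        (v x t * deriv (fun s ↦ φ x s) t + b t * v x t * deriv (fun y ↦ φ y t) x))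
      + ∫ x : ℝ, u₀ x * φ x 0 = 0

/-- `u(x, t, ω)` is a pathwise weak solution on `ℝ × [0, T]` of the random transport equation
`u_t + (a(t, ω) u)_x = 0`, `u(x, 0, ω) = u₀(x)`: a random field (at each time jointly measurable in
`x` and `ω`, up to null sets) whose realizations are almost surely weak solutions. -/
structure IsPathwiseWeakSolution {Ω : Type*} [MeasurableSpace Ω] (T : ℝ) (a : ℝ → Ω → ℝ)
    (u₀ : ℝ → ℝ) (u : ℝ → ℝ → Ω → ℝ) (P : Measure Ω) : Prop where
  meas : ∀ t ∈ Icc (0 : ℝ) T, AEMeasurable (fun p : ℝ × Ω ↦ u p.1 t p.2) (volume.prod P)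
  sol : ∀ᵐ ω ∂P, IsWeakSolution T (fun t ↦ a t ω) u₀ (fun x t ↦ u x t ω)

/-- `μ t - (a₀ - μ) (e^{-θ t} - 1) / θ`. -/
noncomputable def ouMean (θ μ a₀ t : ℝ) : ℝ :=
  μ * t - (a₀ - μ) * ((Real.exp (-θ * t) - 1) / θ)

/-- `(σ² / θ³) (θ t + 2 e^{-θ t} - e^{-2 θ t} / 2 - 3 / 2)`. -/
noncomputable def ouVar (θ σ t : ℝ) : ℝ :=
  σ ^ 2 / θ ^ 3 *
    (θ * t + 2 * Real.exp (-θ * t) - 1 / 2 * Real.exp (-2 * θ * t) - 3 / 2)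

/-- The density `y ↦ (2 π v)^{-1/2} exp (-(y - m)² / (2 v))`. -/
noncomputable def normalDensity (m v y : ℝ) : ℝ :=
  1 / √(2 * Real.pi * v) * Real.exp (-(y - m) ^ 2 / (2 * v))

/-!
Write `A t ω = ∫ s in 0..t, a s ω`. The theorem is the combination of three facts.

*The law of `A t`.* Variation of constants, applied path by path, gives
`A t = ouMean t + σ ∫ r in 0..t, (B r - B 0) exp (-θ (t - r))` (`integral_eq_of_volterra`). For a
continuous weight `w`, the integral of `B - B 0` against `w` is, by summation by parts, the pathwise
limit of the sums `∑ K(t_k) (B(t_{k+1}) - B(t_k))` with `K s = ∫ r in s..t, w r`. These are sums of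
independent centred Gaussian variables, with variances which are Riemann sums of `∫ K²`. Passing to
the limit in the characteristic functions shows that the integral is `N(0, ∫ K²)`
(`IsBrownianOn.hasLaw_integral`), and `ouVar_eq_integral` computes the variance.

*The transport equation for a fixed path.* In the coordinates `(y, t)` with `x = y + A t` the
operator `∂_t + b ∂_x` becomes `∂_t`. Hence `u₀ (x - A t)` is a weak solution, by Fubini and the
fundamental theorem of calculus (`transport_weak`); its continuity in time is the continuity of
translations in `L²`. Conversely, testing a weak solution `v` with `ψ (x - A t) η t` shows that
`∫ v(x, t) ψ (x - A t) dx` has vanishing weak derivative in time, so that it keeps its initial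
value `∫ u₀ ψ`; as `ψ` is arbitrary, `v(x, t) = u₀ (x - A t)` (`IsWeakSolution.ae_eq`). The velocity
is only given on `[0, T]` and is extended continuously, so that `A` is `C¹` on the whole line.

*The moments.* For `t > 0` the law of `A t` has a bounded density, so that the translates of
`u₀ ∈ L^m` are in `L^m` of this law (`integrable_and_integral_pow_comp_sub`). An arbitrary pathwise
solution agrees with `u₀ (x - A t ω)` for almost every `ω` and then almost every `x`; joint
measurability permits to exchange the two quantifiers (`ae_ae_eq_swap`).
-/

/-! ### Riemann sums -/

/-- The points `t k / n` of the partition of `[0, t]` into `n` equal intervals. -/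
noncomputable def gridPoint (t : ℝ) (n k : ℕ) : ℝ := t * k / n

lemma gridPoint_zero (t : ℝ) (n : ℕ) : gridPoint t n 0 = 0 := by simp [gridPoint]

lemma gridPoint_self (t : ℝ) {n : ℕ} (hn : n ≠ 0) : gridPoint t n n = t := by
  have : (n : ℝ) ≠ 0 := by exact_mod_cast hn
  simp [gridPoint, this]

lemma gridPoint_mono {t : ℝ} (ht : 0 ≤ t) (n : ℕ) : Monotone (gridPoint t n) := by
  intro j k hjk
  have : (j : ℝ) ≤ k := by exact_mod_cast hjk
  unfold gridPoint
  gcongr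

lemma gridPoint_mem {t : ℝ} (ht : 0 ≤ t) {n k : ℕ} (hk : k ≤ n) (hn : n ≠ 0) :
    gridPoint t n k ∈ Icc 0 t := by
  constructor
  · rw [← gridPoint_zero t n]; exact gridPoint_mono ht n (Nat.zero_le k)
  · conv_rhs => rw [← gridPoint_self t hn]
    exact gridPoint_mono ht n hk

lemma gridPoint_succ_sub (t : ℝ) (n k : ℕ) :
    gridPoint t n (k + 1) - gridPoint t n k = t / n := by
  unfold gridPoint; push_cast; ring

/-- Weighted Riemann sums of a continuous function, with arbitrary sample points. -/
lemma tendsto_riemannSum {t : ℝ} (ht : 0 < t) {H G : ℝ → ℝ} (hH : ContinuousOn H (Icc 0 t))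
    (hG : ContinuousOn G (Icc 0 t)) {τ : ℕ → ℕ → ℝ}
    (hτ : ∀ n k, k < n → τ n k ∈ Icc (gridPoint t n k) (gridPoint t n (k + 1))) :
    Tendsto (fun n ↦ ∑ k ∈ Finset.range n,
      H (τ n k) * ∫ r in gridPoint t n k..gridPoint t n (k + 1), G r) atTop
      (𝓝 (∫ r in (0 : ℝ)..t, H r * G r)) := by
  obtain ⟨M, hM⟩ := isCompact_Icc.exists_bound_of_continuousOn hG
  have hM0 : 0 ≤ M := (norm_nonneg _).trans (hM 0 ⟨le_rfl, ht.le⟩)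
  have hunif := isCompact_Icc.uniformContinuousOn_of_continuous hH
  rw [Metric.uniformContinuousOn_iff_le] at hunif
  rw [Metric.tendsto_atTop]
  intro ε hε
  set η : ℝ := ε / (2 * ((M + 1) * t)) with hη
  have hη0 : 0 < η := by positivity
  obtain ⟨δ, hδ, hHδ⟩ := hunif η hη0
  obtain ⟨N, hN⟩ := exists_nat_gt (t / δ)
  refine ⟨N + 1, fun n hn ↦ ?_⟩
  have hn0 : n ≠ 0 := by lia
  have hnpos : (0 : ℝ) < n := by exact_mod_cast Nat.pos_of_ne_zero hn0
  have hmesh : t / n ≤ δ := by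
    rw [div_lt_iff₀ hδ] at hN
    rw [div_le_iff₀ hnpos]
    have : (N : ℝ) ≤ n := by exact_mod_cast (by lia : N ≤ n)
    nlinarith
  have hsub : ∀ k, k < n → Icc (gridPoint t n k) (gridPoint t n (k + 1)) ⊆ Icc 0 t := fun k hk ↦
    Icc_subset_Icc (gridPoint_mem ht.le hk.le hn0).1 (gridPoint_mem ht.le hk hn0).2
  have hle : ∀ k, gridPoint t n k ≤ gridPoint t n (k + 1) := fun k ↦
    gridPoint_mono ht.le n k.le_succ
  have hint : ∀ {F : ℝ → ℝ}, ContinuousOn F (Icc 0 t) → ∀ k, k < n →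
      IntervalIntegrable F volume (gridPoint t n k) (gridPoint t n (k + 1)) := fun hF k hk ↦
    (hF.mono (hsub k hk)).intervalIntegrable_of_Icc (hle k)
  have hHG : ContinuousOn (fun r ↦ H r * G r) (Icc 0 t) := hH.mul hG
  have hsum : ∫ r in (0 : ℝ)..t, H r * G r = ∑ k ∈ Finset.range n,
      ∫ r in gridPoint t n k..gridPoint t n (k + 1), H r * G r := by
    rw [intervalIntegral.sum_integral_adjacent_intervals (hint hHG),
      gridPoint_zero, gridPoint_self t hn0]
  have hterm : ∀ k ∈ Finset.range n,
      ‖H (τ n k) * (∫ r in gridPoint t n k..gridPoint t n (k + 1), G r) -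
        ∫ r in gridPoint t n k..gridPoint t n (k + 1), H r * G r‖ ≤ η * M * (t / n) := by
    intro k hk
    have hk := Finset.mem_range.1 hk
    rw [← intervalIntegral.integral_const_mul,
      ← intervalIntegral.integral_sub ((hint hG k hk).const_mul _) (hint hHG k hk),
      ← gridPoint_succ_sub t n k, ← abs_of_nonneg (sub_nonneg.2 (hle k))]
    refine intervalIntegral.norm_integral_le_of_norm_le_const fun r hr ↦ ?_
    rw [uIoc_of_le (hle k)] at hr
    have hr' := Ioc_subset_Icc_self hr
    have hdist : dist (τ n k) r ≤ δ := by
      refine (Real.dist_le_of_mem_Icc (hτ n k hk) hr').trans ?_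
      rwa [gridPoint_succ_sub]
    rw [← sub_mul, norm_mul]
    have h1 := hHδ _ (hsub k hk (hτ n k hk)) _ (hsub k hk hr') hdist
    rw [Real.dist_eq] at h1
    exact mul_le_mul h1 (hM r (hsub k hk hr')) (norm_nonneg _) hη0.le
  rw [hsum, dist_eq_norm, ← Finset.sum_sub_distrib]
  calc _ ≤ ∑ k ∈ Finset.range n, η * M * (t / n) := norm_sum_le_of_le _ hterm
    _ = η * M * t := by
      rw [Finset.sum_const, Finset.card_range, nsmul_eq_mul]; field_simp
    _ ≤ η * ((M + 1) * t) := by nlinarith [mul_pos hη0 ht]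
    _ = ε / 2 := by rw [hη]; field_simp
    _ < ε := by linarith

/-! ### Integrals of Brownian motion -/

/-- Summation by parts, normalized so that only the differences `b k - b 0` appear. -/
lemma sum_mul_sub_eq (K b : ℕ → ℝ) (n : ℕ) :
    ∑ k ∈ Finset.range n, K k * (b (k + 1) - b k) =
      K n * (b n - b 0) + ∑ k ∈ Finset.range n, (b (k + 1) - b 0) * (K k - K (k + 1)) := by
  induction n with
  | zero => simp
  | succ n ih => rw [Finset.sum_range_succ, Finset.sum_range_succ, ih]; ring

/-- The characteristic function of a linear combination of the increments of Brownian motion over a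
grid. -/
lemma IsBrownianOn.charFun_sum_increments {Ω : Type*} [MeasurableSpace Ω] {P : Measure Ω}
    [IsProbabilityMeasure P] {T : ℝ} {B : ℝ → Ω → ℝ} (hB : IsBrownianOn T B P) {t : ℝ}
    (ht : t ∈ Ioc 0 T) {n : ℕ} (hn : n ≠ 0) (K : ℕ → ℝ) (ξ : ℝ) :
    charFun (P.map (fun ω ↦ ∑ k ∈ Finset.range n,
        K k * (B (gridPoint t n (k + 1)) ω - B (gridPoint t n k) ω))) ξ =
      Complex.exp (-((∑ k ∈ Finset.range n, K k ^ 2 * (t / n) : ℝ) : ℂ) * ξ ^ 2 / 2) := by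
  have hmem : ∀ k, k ≤ n → gridPoint t n k ∈ Icc 0 T := fun k hk ↦
    Icc_subset_Icc_right ht.2 (gridPoint_mem ht.1.le hk hn)
  let p : Fin (n + 1) → Icc (0 : ℝ) T := fun i ↦ ⟨gridPoint t n i, hmem i (by lia)⟩
  have hp : Monotone p := fun i j hij ↦ gridPoint_mono ht.1.le n hij
  have hind := (hB.indep n p hp).comp (fun i x ↦ K i * x) (fun i ↦ by fun_prop)
  have hlaw : ∀ k : Fin n, HasLaw (fun ω ↦ K k *
      (B (gridPoint t n (k + 1)) ω - B (gridPoint t n k) ω))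
      (gaussianReal 0 (.mk (K k ^ 2) (sq_nonneg _) * (t / n).toNNReal)) P := by
    intro k
    have h := hB.law _ _ (hmem k k.2.le).1 (gridPoint_mono ht.1.le n k.1.le_succ)
      (hmem (k + 1) k.2).2
    rw [gridPoint_succ_sub] at h
    simpa using gaussianReal_const_mul h (K k)
  have hfun : (fun ω ↦ ∑ k ∈ Finset.range n,
        K k * (B (gridPoint t n (k + 1)) ω - B (gridPoint t n k) ω)) =
      fun ω ↦ ∑ k : Fin n, K k * (B (gridPoint t n (k + 1)) ω - B (gridPoint t n k) ω) := by
    ext ω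
    exact Finset.sum_range (fun k ↦ K k * (B (gridPoint t n (k + 1)) ω - B (gridPoint t n k) ω))
  have := iIndepFun.charFun_map_fun_sum_eq_prod (fun k ↦ (hlaw k).aemeasurable) hind
  rw [hfun, this, Finset.prod_apply]
  simp_rw [(hlaw _).map_eq, charFun_gaussianReal]
  rw [← Complex.exp_sum, Finset.sum_range]
  congr 1
  have htn : 0 ≤ t / n := div_nonneg ht.1.le n.cast_nonneg
  simp [Real.coe_toNNReal _ htn, NNReal.coe_mul, Finset.sum_mul, Finset.sum_div, neg_div]

/-- A variable is Gaussian if it is the almost sure limit of variables whose characteristic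
functions are centred Gaussian, with convergent variances. -/
lemma hasLaw_gaussianReal_of_tendsto {Ω : Type*} [MeasurableSpace Ω] {P : Measure Ω}
    [IsProbabilityMeasure P] {S : ℕ → Ω → ℝ} {X : Ω → ℝ} {v : ℕ → ℝ} {V : ℝ} (hV : 0 ≤ V)
    (hS : ∀ᶠ n in atTop, AEMeasurable (S n) P)
    (hchar : ∀ᶠ n in atTop, ∀ ξ : ℝ,
      charFun (P.map (S n)) ξ = Complex.exp (-(v n : ℂ) * ξ ^ 2 / 2))
    (hlim : ∀ᵐ ω ∂P, Tendsto (fun n ↦ S n ω) atTop (𝓝 (X ω)))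
    (hv : Tendsto v atTop (𝓝 V)) :
    HasLaw X (gaussianReal 0 V.toNNReal) P := by
  obtain ⟨N, hN⟩ := eventually_atTop.1 hS
  have hX : AEMeasurable X P := by
    refine aemeasurable_of_tendsto_metrizable_ae' (f := fun n ↦ S (n + N))
      (fun n ↦ hN _ (Nat.le_add_left N n)) ?_
    filter_upwards [hlim] with ω hω using hω.comp (tendsto_add_atTop_nat N)
  refine ⟨hX, ?_⟩
  have : IsProbabilityMeasure (P.map X) := Measure.isProbabilityMeasure_map hX
  refine Measure.ext_of_charFun (funext fun ξ ↦ ?_)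
  have hmap : ∀ {Y : Ω → ℝ}, AEMeasurable Y P →
      charFun (P.map Y) ξ = ∫ ω, Complex.exp (ξ * Y ω * Complex.I) ∂P := by
    intro Y hY
    rw [charFun_apply_real, integral_map hY (by fun_prop)]
  have h1 : Tendsto (fun n ↦ charFun (P.map (S n)) ξ) atTop (𝓝 (charFun (P.map X) ξ)) := by
    rw [hmap hX]
    refine Tendsto.congr' (f₁ := fun n ↦ ∫ ω, Complex.exp (ξ * S n ω * Complex.I) ∂P) ?_ ?_
    · filter_upwards [hS] with n hn using (hmap hn).symm
    · refine tendsto_integral_filter_of_dominated_convergence (fun _ ↦ 1) ?_ ?_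
        (integrable_const _) ?_
      · filter_upwards [hS] with n hn
        exact (Complex.measurable_exp.comp_aemeasurable (by fun_prop)).aestronglyMeasurable
      · refine Eventually.of_forall fun n ↦ Eventually.of_forall fun ω ↦ ?_
        rw [← Complex.ofReal_mul, Complex.norm_exp_ofReal_mul_I]
      · filter_upwards [hlim] with ω hω
        have hc : Continuous fun y : ℝ ↦ Complex.exp (ξ * y * Complex.I) := by fun_prop
        exact (hc.tendsto (X ω)).comp hω
  have h2 : Tendsto (fun n ↦ charFun (P.map (S n)) ξ) atTop
      (𝓝 (Complex.exp (-(V : ℂ) * ξ ^ 2 / 2))) := by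
    refine Tendsto.congr' (f₁ := fun n ↦ Complex.exp (-(v n : ℂ) * ξ ^ 2 / 2)) ?_ ?_
    · filter_upwards [hchar] with n hn using (hn ξ).symm
    · have hc : Continuous fun y : ℝ ↦ Complex.exp (-(y : ℂ) * ξ ^ 2 / 2) := by fun_prop
      exact (hc.tendsto V).comp hv
  rw [tendsto_nhds_unique h1 h2, charFun_gaussianReal, Real.coe_toNNReal _ hV]
  congr 1
  push_cast
  ring

/-- The integral of a Brownian path against a continuous weight `w` is a centred Gaussian variable.
With `K s = ∫ r in s..t, w r` it is the Wiener integral of `K`, which gives the variance. -/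
lemma IsBrownianOn.hasLaw_integral {Ω : Type*} [MeasurableSpace Ω] {P : Measure Ω}
    [IsProbabilityMeasure P] {T : ℝ} {B : ℝ → Ω → ℝ} (hB : IsBrownianOn T B P) {t : ℝ}
    (ht : t ∈ Ioc 0 T) {w : ℝ → ℝ} (hw : Continuous w) :
    HasLaw (fun ω ↦ ∫ r in (0 : ℝ)..t, (B r ω - B 0 ω) * w r)
      (gaussianReal 0 (∫ s in (0 : ℝ)..t, (∫ r in s..t, w r) ^ 2).toNNReal) P := by
  set K : ℝ → ℝ := fun s ↦ ∫ r in s..t, w r with hK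
  have hKcont : Continuous K := by
    have : K = fun s ↦ -∫ r in t..s, w r := funext fun s ↦ intervalIntegral.integral_symm _ _
    rw [this]
    exact (intervalIntegral.continuous_primitive (fun a b ↦ hw.intervalIntegrable a b) t).neg
  have hKsub : ∀ x y, K x - K y = ∫ r in x..y, w r := fun x y ↦ by
    rw [hK, sub_eq_iff_eq_add]
    exact (intervalIntegral.integral_add_adjacent_intervals (hw.intervalIntegrable _ _)
      (hw.intervalIntegrable _ _)).symm
  refine hasLaw_gaussianReal_of_tendsto
    (S := fun n ω ↦ ∑ k ∈ Finset.range n, K (gridPoint t n k) *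
      (B (gridPoint t n (k + 1)) ω - B (gridPoint t n k) ω))
    (v := fun n ↦ ∑ k ∈ Finset.range n, K (gridPoint t n k) ^ 2 * (t / n))
    (intervalIntegral.integral_nonneg ht.1.le fun s _ ↦ sq_nonneg _) ?_ ?_ ?_ ?_
  · filter_upwards [eventually_ne_atTop 0] with n hn
    refine Finset.aemeasurable_fun_sum _ fun k hk ↦ ?_
    have hk := Finset.mem_range.1 hk
    exact (hB.law _ _ (gridPoint_mem ht.1.le hk.le hn).1 (gridPoint_mono ht.1.le n k.le_succ)
      ((gridPoint_mem ht.1.le hk hn).2.trans ht.2)).aemeasurable.const_mul _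
  · filter_upwards [eventually_ne_atTop 0] with n hn ξ
    exact hB.charFun_sum_increments ht hn _ ξ
  · filter_upwards [hB.cont] with ω hω
    have hcont : ContinuousOn (fun r ↦ B r ω - B 0 ω) (Icc 0 t) :=
      (hω.mono (Icc_subset_Icc_right ht.2)).sub continuousOn_const
    refine (tendsto_riemannSum ht.1 hcont hw.continuousOn
      (τ := fun n k ↦ gridPoint t n (k + 1))
      fun n k _ ↦ ⟨gridPoint_mono ht.1.le n k.le_succ, le_rfl⟩).congr' ?_
    filter_upwards [eventually_ne_atTop 0] with n hn
    rw [sum_mul_sub_eq (fun k ↦ K (gridPoint t n k)) (fun k ↦ B (gridPoint t n k) ω) n,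
      gridPoint_self t hn, gridPoint_zero]
    simp only [hKsub]
    simp [hK]
  · have := tendsto_riemannSum ht.1 (H := fun s ↦ K s ^ 2) (G := fun _ ↦ 1)
      (hKcont.pow 2).continuousOn continuousOn_const (τ := fun n k ↦ gridPoint t n k)
      fun n k _ ↦ ⟨le_rfl, gridPoint_mono ht.1.le n k.le_succ⟩
    simpa [gridPoint_succ_sub] using this

/-! ### The integrated Ornstein–Uhlenbeck process -/

/-- The integral of a solution of the linear Volterra equation `a = a₀ + ∫ θ (μ - a) + σ β`, by
variation of constants. -/
lemma integral_eq_of_volterra {T θ μ σ a₀ : ℝ} (hθ : θ ≠ 0) {a β : ℝ → ℝ}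
    (ha : ContinuousOn a (Icc 0 T)) (hβ : ContinuousOn β (Icc 0 T))
    (heq : ∀ t ∈ Icc (0 : ℝ) T, a t = a₀ + (∫ s in (0 : ℝ)..t, θ * (μ - a s)) + σ * β t)
    {t : ℝ} (ht : t ∈ Icc 0 T) :
    ∫ s in (0 : ℝ)..t, a s =
      ouMean θ μ a₀ t + σ * ∫ r in (0 : ℝ)..t, β r * Real.exp (-θ * (t - r)) := by
  have hsub : Icc 0 t ⊆ Icc 0 T := Icc_subset_Icc_right ht.2
  have hint : ∀ s ∈ Icc (0 : ℝ) T, IntervalIntegrable a volume 0 s := fun s hs ↦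
    (ha.mono (Icc_subset_Icc_right hs.2)).intervalIntegrable_of_Icc hs.1
  set X : ℝ → ℝ := fun s ↦ ∫ r in (0 : ℝ)..s, a r with hX
  have hXcont : ContinuousOn X (Icc 0 t) := by
    have := intervalIntegral.continuousOn_primitive_interval
      (μ := volume) (f := a) (a := 0) (b := t)
      ((ha.mono (by rwa [uIcc_of_le ht.1])).integrableOn_compact isCompact_uIcc)
    rwa [uIcc_of_le ht.1] at this
  have haX : ∀ s ∈ Icc (0 : ℝ) T, a s = a₀ + θ * (μ * s - X s) + σ * β s := fun s hs ↦ by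
    rw [heq s hs, intervalIntegral.integral_const_mul, intervalIntegral.integral_sub (by simp)
      (hint s hs)]
    simp [hX, mul_comm]
  have hXd : ∀ s ∈ Ioo (0 : ℝ) t, HasDerivAt X (a s) s := fun s hs ↦ by
    have hs' : s ∈ Ioo 0 T := ⟨hs.1, hs.2.trans_le ht.2⟩
    have hnhds : Icc 0 T ∈ 𝓝 s := Icc_mem_nhds hs'.1 hs'.2
    exact intervalIntegral.integral_hasDerivAt_right (hint s (Ioo_subset_Icc_self hs'))
      (ha.stronglyMeasurableAtFilter_nhdsWithin measurableSet_Icc s |>.filter_mono (by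
        rw [nhdsWithin_eq_nhds.2 hnhds]))
      (ha.continuousAt hnhds)
  have hmd : ∀ s, HasDerivAt (ouMean θ μ a₀) (μ + (a₀ - μ) * Real.exp (-θ * s)) s := fun s ↦ by
    have h1 : HasDerivAt (fun s ↦ Real.exp (-θ * s)) (Real.exp (-θ * s) * (-θ)) s := by
      simpa using ((hasDerivAt_id s).const_mul (-θ)).exp
    have := ((hasDerivAt_id s).const_mul μ).sub (((h1.sub_const 1).div_const θ).const_mul (a₀ - μ))
    refine this.congr_deriv ?_
    field_simp
    ring
  -- `exp (θ s) (X s - ouMean s)` has derivative `σ exp (θ s) β s`.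
  have hftc : ∫ s in (0 : ℝ)..t, σ * (Real.exp (θ * s) * β s) =
      Real.exp (θ * t) * (X t - ouMean θ μ a₀ t) - Real.exp (θ * 0) * (X 0 - ouMean θ μ a₀ 0) := by
    refine intervalIntegral.integral_eq_sub_of_hasDerivAt_of_le
      (f := fun s ↦ Real.exp (θ * s) * (X s - ouMean θ μ a₀ s)) ht.1 ?_ ?_ ?_
    · have : Continuous (ouMean θ μ a₀) := by unfold ouMean; fun_prop
      fun_prop
    · intro s hs
      have h1 : HasDerivAt (fun s ↦ Real.exp (θ * s)) (Real.exp (θ * s) * θ) s := by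
        simpa using ((hasDerivAt_id s).const_mul θ).exp
      refine (h1.mul ((hXd s hs).sub (hmd s))).congr_deriv ?_
      rw [haX s (hsub (Ioo_subset_Icc_self hs)), Pi.sub_apply]
      unfold ouMean
      field_simp
      ring
    · have := hβ.mono hsub
      exact ContinuousOn.intervalIntegrable_of_Icc ht.1 (by fun_prop)
  have hzero : X 0 - ouMean θ μ a₀ 0 = 0 := by simp [hX, ouMean]
  rw [hzero, mul_zero, sub_zero, intervalIntegral.integral_const_mul] at hftc
  have hker : ∫ r in (0 : ℝ)..t, β r * Real.exp (-θ * (t - r)) =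
      Real.exp (-(θ * t)) * ∫ r in (0 : ℝ)..t, Real.exp (θ * r) * β r := by
    rw [← intervalIntegral.integral_const_mul]
    refine intervalIntegral.integral_congr fun r _ ↦ ?_
    rw [← mul_assoc, ← Real.exp_add, mul_comm]
    ring_nf
  rw [hker, ← mul_assoc, mul_comm σ, mul_assoc, hftc, ← mul_assoc, ← Real.exp_add]
  simp [hX]

lemma integral_ouKernel {θ : ℝ} (hθ : θ ≠ 0) (s t : ℝ) :
    ∫ r in s..t, Real.exp (-θ * (t - r)) = (1 - Real.exp (-θ * (t - s))) / θ := by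
  have hd : ∀ r ∈ uIcc s t, HasDerivAt (fun r ↦ Real.exp (-θ * (t - r)) / θ)
      (Real.exp (-θ * (t - r))) r := fun r _ ↦ by
    have h := ((((hasDerivAt_id r).const_sub t).const_mul (-θ)).exp).div_const θ
    refine h.congr_deriv ?_
    simp
    field_simp
  rw [intervalIntegral.integral_eq_sub_of_hasDerivAt hd
    ((by fun_prop : Continuous _).intervalIntegrable _ _)]
  simp [sub_div]

lemma ouVar_eq_integral {θ : ℝ} (hθ : θ ≠ 0) (σ t : ℝ) :
    ouVar θ σ t = σ ^ 2 * ∫ s in (0 : ℝ)..t, (∫ r in s..t, Real.exp (-θ * (t - r))) ^ 2 := by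
  simp_rw [integral_ouKernel hθ]
  have hd : ∀ s ∈ uIcc 0 t, HasDerivAt (fun s ↦ (s - 2 * Real.exp (-θ * (t - s)) / θ +
      Real.exp (-θ * (t - s)) ^ 2 / (2 * θ)) / θ ^ 2)
      (((1 - Real.exp (-θ * (t - s))) / θ) ^ 2) s := fun s _ ↦ by
    have h := (((hasDerivAt_id s).const_sub t).const_mul (-θ)).exp
    refine ((((hasDerivAt_id s).sub ((h.const_mul 2).div_const θ)).add
      ((h.pow 2).div_const (2 * θ))).div_const (θ ^ 2)).congr_deriv ?_
    simp
    field_simp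
    ring
  rw [intervalIntegral.integral_eq_sub_of_hasDerivAt hd
    ((by fun_prop : Continuous _).intervalIntegrable _ _)]
  have h2 : Real.exp (-2 * θ * t) = Real.exp (-θ * t) ^ 2 := by
    rw [← Real.exp_nat_mul]; ring_nf
  rw [ouVar, h2]
  simp
  field_simp
  ring

lemma ouVar_pos {θ σ t : ℝ} (hθ : 0 < θ) (hσ : 0 < σ) (ht : 0 < t) : 0 < ouVar θ σ t := by
  rw [ouVar_eq_integral hθ.ne']
  refine mul_pos (pow_pos hσ 2) ?_
  simp_rw [integral_ouKernel hθ.ne']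
  refine intervalIntegral.intervalIntegral_pos_of_pos_on
    ((by fun_prop : Continuous _).intervalIntegrable _ _) (fun s hs ↦ ?_) ht
  have : Real.exp (-θ * (t - s)) < 1 := by
    rw [Real.exp_lt_one_iff]
    nlinarith [mul_pos hθ (sub_pos.2 hs.2)]
  have : 0 < 1 - Real.exp (-θ * (t - s)) := sub_pos.2 this
  positivity

/-- The integrated Ornstein–Uhlenbeck process is Gaussian. -/
lemma IsOrnsteinUhlenbeck.hasLaw_integral {Ω : Type*} [MeasurableSpace Ω] {P : Measure Ω}
    [IsProbabilityMeasure P] {T θ μ σ a₀ : ℝ} (hθ : 0 < θ) {B a : ℝ → Ω → ℝ}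
    (hB : IsBrownianOn T B P) (ha : IsOrnsteinUhlenbeck T θ μ σ a₀ B a P) {t : ℝ}
    (ht : t ∈ Ioc 0 T) :
    HasLaw (fun ω ↦ ∫ s in (0 : ℝ)..t, a s ω)
      (gaussianReal (ouMean θ μ a₀ t) (ouVar θ σ t).toNNReal) P := by
  have h := gaussianReal_const_add (gaussianReal_const_mul
    (hB.hasLaw_integral ht (w := fun r ↦ Real.exp (-θ * (t - r))) (by fun_prop)) σ)
    (ouMean θ μ a₀ t)
  have hv : NNReal.mk (σ ^ 2) (sq_nonneg _) *
      (∫ s in (0 : ℝ)..t, (∫ r in s..t, Real.exp (-θ * (t - r))) ^ 2).toNNReal =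
        (ouVar θ σ t).toNNReal := by
    rw [ouVar_eq_integral hθ.ne', Real.toNNReal_mul (sq_nonneg _)]
    congr 1
    exact (Real.toNNReal_of_nonneg (sq_nonneg _)).symm
  rw [hv, mul_zero, zero_add] at h
  refine h.congr ?_
  filter_upwards [ha.cont, ha.eqn, hB.cont] with ω hc he hBc
  exact integral_eq_of_volterra hθ.ne' hc (hBc.sub continuousOn_const) he ⟨ht.1.le, ht.2⟩

/-! ### Translations in `L²` -/

lemma MeasureTheory.MemLp.comp_sub_const {f : ℝ → ℝ} (hf : MemLp f 2 volume) (h : ℝ) :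
    MemLp (fun x ↦ f (x - h)) 2 volume :=
  hf.comp_measurePreserving (measurePreserving_sub_right volume h)

/-- Translation is continuous in `L²`. -/
lemma MeasureTheory.MemLp.continuous_toLp_comp_sub {f : ℝ → ℝ} (hf : MemLp f 2 volume) :
    Continuous (fun h : ℝ ↦ (hf.comp_sub_const h).toLp (fun x ↦ f (x - h))) := by
  have hc : Continuous fun h : ℝ ↦ (⟨fun x ↦ x - h, by fun_prop⟩ : C(ℝ, ℝ)) :=
    ContinuousMap.continuous_of_continuous_uncurry _
      (show Continuous fun p : ℝ × ℝ ↦ p.2 - p.1 by fun_prop)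
  exact (continuous_const (y := hf.toLp f)).compMeasurePreservingLp hc
    (fun h ↦ measurePreserving_sub_right volume h) (by simp)

/-! ### Straightening the characteristics -/

/-- The shear `(y, t) ↦ (y + A t, t)`, which maps vertical lines to the characteristics of the
transport equation whose velocity has primitive `A`. -/
def shear (A : ℝ → ℝ) (hA : Continuous A) : ℝ × ℝ ≃ₜ ℝ × ℝ where
  toFun p := (p.1 + A p.2, p.2)
  invFun p := (p.1 - A p.2, p.2)
  left_inv p := by simp
  right_inv p := by simp
  continuous_toFun := by fun_prop
  continuous_invFun := by fun_prop

lemma hasDerivAt_primitive {b : ℝ → ℝ} (hb : Continuous b) (t : ℝ) :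
    HasDerivAt (fun t ↦ ∫ s in (0 : ℝ)..t, b s) (b t) t :=
  intervalIntegral.integral_hasDerivAt_right (hb.intervalIntegrable _ _)
    hb.stronglyMeasurable.stronglyMeasurableAtFilter hb.continuousAt

lemma contDiff_primitive {b : ℝ → ℝ} (hb : Continuous b) :
    ContDiff ℝ 1 (fun t ↦ ∫ s in (0 : ℝ)..t, b s) := by
  refine contDiff_one_iff_deriv.2 ⟨fun t ↦ (hasDerivAt_primitive hb t).differentiableAt, ?_⟩
  rwa [show deriv (fun t ↦ ∫ s in (0 : ℝ)..t, b s) = b from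
    funext fun t ↦ (hasDerivAt_primitive hb t).deriv]

lemma primitive_congr {T t : ℝ} {b b' : ℝ → ℝ} (h : EqOn b b' (Icc 0 T)) (ht : t ∈ Icc 0 T) :
    ∫ s in (0 : ℝ)..t, b s = ∫ s in (0 : ℝ)..t, b' s := by
  refine intervalIntegral.integral_congr fun s hs ↦ ?_
  rw [uIcc_of_le ht.1] at hs
  exact h ⟨hs.1, hs.2.trans ht.2⟩

lemma ContinuousOn.exists_continuous_eqOn_Icc {T : ℝ} (hT : 0 ≤ T) {b : ℝ → ℝ}
    (hb : ContinuousOn b (Icc 0 T)) : ∃ b' : ℝ → ℝ, Continuous b' ∧ EqOn b b' (Icc 0 T) :=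
  ⟨IccExtend hT ((Icc 0 T).domRestrict b), hb.domRestrict.Icc_extend', fun s hs ↦ by
    rw [IccExtend_of_mem _ _ hs, domRestrict_apply]⟩

lemma IsWeakSolution.congr {T : ℝ} (hT : 0 ≤ T) {b b' u₀ : ℝ → ℝ} {v : ℝ → ℝ → ℝ}
    (h : IsWeakSolution T b u₀ v) (hb : EqOn b b' (Icc 0 T)) : IsWeakSolution T b' u₀ v where
  memLp := h.memLp
  cont := h.cont
  weak φ hφ := by
    refine Eq.trans ?_ (h.weak φ hφ)
    congr 1
    refine intervalIntegral.integral_congr fun t ht ↦ ?_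
    rw [uIcc_of_le hT] at ht
    simp only [hb ht]

/-- The translated initial datum satisfies the weak formulation: in the sheared variable the
integrand is `u₀ y` times a total time derivative. -/
lemma transport_weak {T : ℝ} {b u₀ : ℝ → ℝ} (hb : Continuous b) (hu₀ : MemLp u₀ 2 volume)
    {φ : ℝ → ℝ → ℝ} (hφ : IsTestFunction T φ) :
    (∫ t in (0 : ℝ)..T, ∫ x : ℝ,
        (u₀ (x - ∫ s in (0 : ℝ)..t, b s) * deriv (fun s ↦ φ x s) t +
          b t * u₀ (x - ∫ s in (0 : ℝ)..t, b s) * deriv (fun y ↦ φ y t) x))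
      + ∫ x : ℝ, u₀ x * φ x 0 = 0 := by
  set A : ℝ → ℝ := fun t ↦ ∫ s in (0 : ℝ)..t, b s with hA
  have hAc : ContDiff ℝ 1 A := contDiff_primitive hb
  set Ψ : ℝ × ℝ → ℝ := Function.uncurry φ ∘ shear A hAc.continuous with hΨ
  have hΨc : ContDiff ℝ 1 Ψ :=
    hφ.contDiff.comp ((contDiff_fst.add (hAc.comp contDiff_snd)).prodMk contDiff_snd)
  have hΨs : HasCompactSupport Ψ := hφ.compact.comp_homeomorph _
  set G : ℝ × ℝ → ℝ := fun p ↦ fderiv ℝ Ψ p (0, 1) with hG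
  have hGc : Continuous G := (hΨc.continuous_fderiv (by simp)).clm_apply continuous_const
  have hGs : HasCompactSupport G := hΨs.fderiv_apply (𝕜 := ℝ) _
  have hGd : ∀ y t, HasDerivAt (fun t ↦ φ (y + A t) t) (G (y, t)) t := fun y t ↦
    ((hΨc.differentiable (by simp) (y, t)).hasFDerivAt).comp_hasDerivAt t
      ((hasDerivAt_const t y).prodMk (hasDerivAt_id t))
  have hGeq : ∀ x t, deriv (fun s ↦ φ x s) t + b t * deriv (fun y ↦ φ y t) x =
      G (x - A t, t) := by
    intro x t
    have hd : HasFDerivAt (Function.uncurry φ) (fderiv ℝ (Function.uncurry φ) (x, t)) (x, t) :=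
      (hφ.contDiff.differentiable (by simp) _).hasFDerivAt
    have h1 : HasDerivAt (fun s ↦ φ x s) (fderiv ℝ (Function.uncurry φ) (x, t) (0, 1)) t :=
      hd.comp_hasDerivAt t ((hasDerivAt_const t x).prodMk (hasDerivAt_id t))
    have h2 : HasDerivAt (fun y ↦ φ y t) (fderiv ℝ (Function.uncurry φ) (x, t) (1, 0)) x :=
      hd.comp_hasDerivAt (f := fun y ↦ (y, t)) x ((hasDerivAt_id x).prodMk (hasDerivAt_const x t))
    have h3 : HasDerivAt (fun s ↦ φ (x - A t + A s) s)
        (fderiv ℝ (Function.uncurry φ) (x, t) (b t, 1)) t := by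
      have hd' : HasFDerivAt (Function.uncurry φ) (fderiv ℝ (Function.uncurry φ) (x, t))
          (x - A t + A t, t) := by simpa using hd
      exact hd'.comp_hasDerivAt (f := fun s ↦ (x - A t + A s, s)) t
        (((hasDerivAt_primitive hb t).const_add (x - A t)).prodMk (hasDerivAt_id t))
    rw [h1.deriv, h2.deriv, (hGd (x - A t) t).unique h3, ← smul_eq_mul, ← map_smul, ← map_add]
    simp
  have hinner : ∀ t, ∫ x : ℝ, (u₀ (x - A t) * deriv (fun s ↦ φ x s) t +
      b t * u₀ (x - A t) * deriv (fun y ↦ φ y t) x) = ∫ y : ℝ, u₀ y * G (y, t) := by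
    intro t
    rw [← integral_sub_right_eq_self (fun y ↦ u₀ y * G (y, t)) (A t)]
    refine integral_congr_ae (Eventually.of_forall fun x ↦ ?_)
    beta_reduce
    rw [← hGeq]
    ring
  change (∫ t in (0 : ℝ)..T, ∫ x : ℝ, (u₀ (x - A t) * deriv (fun s ↦ φ x s) t +
      b t * u₀ (x - A t) * deriv (fun y ↦ φ y t) x)) + ∫ x : ℝ, u₀ x * φ x 0 = 0
  simp_rw [hinner]
  have hint : Integrable (Function.uncurry fun t y ↦ u₀ y * G (y, t))
      ((volume.restrict (uIoc 0 T)).prod volume) := by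
    obtain ⟨C, hC⟩ := hGs.exists_bound_of_continuous hGc
    set K : Set ℝ := Prod.fst '' tsupport G with hK
    have hKc : IsCompact K := hGs.isCompact.image continuous_fst
    have huK : Integrable (K.indicator u₀) volume :=
      (integrable_indicator_iff hKc.measurableSet).2
        ((hu₀.locallyIntegrable (by norm_num)).integrableOn_isCompact hKc)
    have : IsFiniteMeasure ((volume : Measure ℝ).restrict (uIoc 0 T)) := by
      rw [uIoc]
      infer_instance
    have h1 : Integrable (fun p : ℝ × ℝ ↦ G (p.2, p.1) * (1 * K.indicator u₀ p.2))
        ((volume.restrict (uIoc 0 T)).prod volume) := by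
      refine Integrable.bdd_mul (c := C) 
        (Integrable.mul_prod (f := fun _ ↦ (1 : ℝ)) (integrable_const 1) huK) ?_
        (Eventually.of_forall fun p ↦ hC _)
      exact (by fun_prop : Continuous fun p : ℝ × ℝ ↦ G (p.2, p.1)).aestronglyMeasurable
    refine h1.congr (Eventually.of_forall fun p ↦ ?_)
    by_cases hp : p.2 ∈ K
    · simp [Function.uncurry, hp, mul_comm]
    · have : G (p.2, p.1) = 0 := by
        by_contra hne
        exact hp ⟨_, subset_tsupport _ hne, rfl⟩
      simp [Function.uncurry, this]
  rw [intervalIntegral_integral_swap hint]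
  have hT0 : ∀ x, φ x T = 0 := fun x ↦ by
    by_contra hne
    exact lt_irrefl T (hφ.supp (subset_tsupport (Function.uncurry φ)
      (show Function.uncurry φ (x, T) ≠ 0 from hne)))
  have hftc : ∀ y, ∫ t in (0 : ℝ)..T, u₀ y * G (y, t) = -(u₀ y * φ y 0) := fun y ↦ by
    rw [intervalIntegral.integral_const_mul,
      intervalIntegral.integral_eq_sub_of_hasDerivAt (fun t _ ↦ hGd y t)
        ((by fun_prop : Continuous fun t ↦ G (y, t)).intervalIntegrable _ _), hT0]
    simp [hA]
  simp_rw [hftc, integral_neg]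
  ring

lemma isWeakSolution_transport {T : ℝ} (hT : 0 ≤ T) {b u₀ : ℝ → ℝ}
    (hb : ContinuousOn b (Icc 0 T)) (hu₀ : MemLp u₀ 2 volume) :
    IsWeakSolution T b u₀ (fun x t ↦ u₀ (x - ∫ s in (0 : ℝ)..t, b s)) where
  memLp t _ := hu₀.comp_sub_const _
  cont t ht := by
    have hA : ContinuousWithinAt (fun t ↦ ∫ s in (0 : ℝ)..t, b s) (Icc 0 T) t := by
      have := intervalIntegral.continuousOn_primitive_interval
        (μ := volume) (f := b) (a := 0) (b := T)
        ((hb.mono (by rw [uIcc_of_le hT])).integrableOn_compact isCompact_uIcc)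
      rw [uIcc_of_le hT] at this
      exact this t ht
    exact (Lp.tendsto_Lp_iff_tendsto_eLpNorm'' _ (fun _ ↦ hu₀.comp_sub_const _) _
      (hu₀.comp_sub_const _)).1 ((hu₀.continuous_toLp_comp_sub.tendsto _).comp hA)
  weak φ hφ := by
    obtain ⟨b', hb'c, heq⟩ := hb.exists_continuous_eqOn_Icc hT
    have h := transport_weak hb'c hu₀ hφ
    refine Eq.trans ?_ h
    congr 1
    refine intervalIntegral.integral_congr fun t ht ↦ ?_
    rw [uIcc_of_le hT] at ht
    simp only [primitive_congr heq ht, heq ht]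

/-! ### Uniqueness of weak solutions -/

/-- The pairing of a weak solution with a test function moving along the characteristics is a
continuous function of time. -/
lemma IsWeakSolution.continuousOn_pairing {T : ℝ} {b u₀ A ψ : ℝ → ℝ} {v : ℝ → ℝ → ℝ}
    (h : IsWeakSolution T b u₀ v) (hA : Continuous A) (hψ : MemLp ψ 2 volume) :
    ContinuousOn (fun t ↦ ∫ x, v x t * ψ (x - A t)) (Icc 0 T) := by
  rw [continuousOn_iff_continuous_domRestrict]
  let V : Icc (0 : ℝ) T → Lp ℝ 2 volume := fun t ↦ (h.memLp t t.2).toLp (fun x ↦ v x t)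
  have hV : Continuous V := by
    refine continuous_iff_continuousAt.2 fun t ↦ ?_
    refine (Lp.tendsto_Lp_iff_tendsto_eLpNorm'' _ (fun s : Icc (0 : ℝ) T ↦ h.memLp s s.2) _
      (h.memLp t t.2)).2 ?_
    refine (h.cont t t.2).comp ?_
    rw [tendsto_nhdsWithin_iff]
    exact ⟨continuous_subtype_val.tendsto t, Eventually.of_forall fun s ↦ s.2⟩
  have hW := hψ.continuous_toLp_comp_sub.comp 
    (hA.comp (continuous_subtype_val (p := (· ∈ Icc 0 T))))
  refine (hW.inner hV (𝕜 := ℝ)).congr fun t ↦ ?_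
  rw [L2.inner_def]
  refine integral_congr_ae ?_
  filter_upwards [(hψ.comp_sub_const (A t)).coeFn_toLp, (h.memLp t t.2).coeFn_toLp] with x h1 h2
  simp only [Function.comp_apply, V] at h1 h2 ⊢
  rw [h1, h2]
  rfl

lemma isTestFunction_along_characteristics {T : ℝ} {A ψ η : ℝ → ℝ} (hA : ContDiff ℝ 1 A)
    (hψ : ContDiff ℝ 1 ψ) (hψs : HasCompactSupport ψ) (hη : ContDiff ℝ 1 η)
    (hηs : HasCompactSupport η) (hηT : tsupport η ⊆ Iio T) :
    IsTestFunction T (fun x t ↦ ψ (x - A t) * η t) := by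
  have hsub : tsupport (Function.uncurry fun x t ↦ ψ (x - A t) * η t) ⊆
      shear A hA.continuous '' (tsupport ψ ×ˢ tsupport η) := by
    have hK : IsCompact (shear A hA.continuous '' (tsupport ψ ×ˢ tsupport η)) :=
      (hψs.isCompact.prod hηs.isCompact).image (shear A hA.continuous).continuous
    refine closure_minimal (fun p hp ↦ ?_) hK.isClosed
    have hp' : ψ (p.1 - A p.2) * η p.2 ≠ 0 := hp
    exact ⟨(p.1 - A p.2, p.2), ⟨subset_tsupport _ (left_ne_zero_of_mul hp'),
      subset_tsupport _ (right_ne_zero_of_mul hp')⟩, by simp [shear]⟩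
  refine ⟨?_, ?_, ?_⟩
  · exact (hψ.comp (contDiff_fst.sub (hA.comp contDiff_snd))).mul (hη.comp contDiff_snd)
  · exact HasCompactSupport.of_support_subset_isCompact
      ((hψs.isCompact.prod hηs.isCompact).image (shear A hA.continuous).continuous)
      ((subset_tsupport _).trans hsub)
  · intro p hp
    obtain ⟨q, hq, rfl⟩ := hsub hp
    exact hηT hq.2

/-- Along the characteristics the weak formulation becomes an ordinary differential equation in
time, in weak form. -/
lemma IsWeakSolution.integral_deriv_mul_pairing {T : ℝ} {b u₀ ψ η : ℝ → ℝ} {v : ℝ → ℝ → ℝ}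
    (hb : Continuous b) (h : IsWeakSolution T b u₀ v) (hψ : ContDiff ℝ 1 ψ)
    (hψs : HasCompactSupport ψ) (hη : ContDiff ℝ 1 η) (hηs : HasCompactSupport η)
    (hηT : tsupport η ⊆ Iio T) :
    (∫ t in (0 : ℝ)..T, deriv η t * ∫ x, v x t * ψ (x - ∫ s in (0 : ℝ)..t, b s)) +
      η 0 * ∫ x, u₀ x * ψ x = 0 := by
  have hA := contDiff_primitive hb
  refine Eq.trans ?_ (h.weak _ (isTestFunction_along_characteristics hA hψ hψs hη hηs hηT))
  congr 1
  · refine intervalIntegral.integral_congr fun t _ ↦ ?_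
    rw [← integral_const_mul]
    refine integral_congr_ae (Eventually.of_forall fun x ↦ ?_)
    have hψd : HasDerivAt ψ (deriv ψ (x - ∫ s in (0 : ℝ)..t, b s)) (x - ∫ s in (0 : ℝ)..t, b s) :=
      (hψ.differentiable (by simp) _).hasDerivAt
    have h1 := (hψd.comp t ((hasDerivAt_primitive hb t).const_sub x)).mul
      (hη.differentiable (by simp) t).hasDerivAt
    have h2 := (hψd.comp x ((hasDerivAt_id x).sub_const _)).mul_const (η t)
    have e1 : deriv (fun s ↦ ψ (x - ∫ r in (0 : ℝ)..s, b r) * η s) t = _ := h1.deriv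
    have e2 : deriv (fun y ↦ ψ (y - ∫ r in (0 : ℝ)..t, b r) * η t) x = _ := h2.deriv
    simp only [e1, e2, Function.comp_apply, mul_one]
    ring
  · rw [← integral_const_mul]
    refine integral_congr_ae (Eventually.of_forall fun x ↦ ?_)
    simp
    ring

/-- A continuous function which is constant in the weak sense, with initial value `c`. -/
lemma eqOn_const_of_weak_deriv {T : ℝ} (hT : 0 < T) {g : ℝ → ℝ} {c : ℝ}
    (hg : ContinuousOn g (Icc 0 T))
    (h : ∀ η : ℝ → ℝ, ContDiff ℝ 1 η → HasCompactSupport η → tsupport η ⊆ Iio T →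
      (∫ t in (0 : ℝ)..T, deriv η t * g t) + η 0 * c = 0) :
    ∀ t ∈ Icc 0 T, g t = c := by
  have hae : ∀ᵐ t : ℝ, t ∈ Ioo 0 T → g t - c = 0 := by
    refine isOpen_Ioo.ae_eq_zero_of_integral_contDiff_smul_eq_zero
      (((hg.sub continuousOn_const).mono Ioo_subset_Icc_self).locallyIntegrableOn
        measurableSet_Ioo) fun ζ hζ hζs hζT ↦ ?_
    have hζc : Continuous ζ := hζ.continuous
    have hζ0 : ∀ t, t ∉ Ioo 0 T → ζ t = 0 := fun t ht ↦ by
      by_contra hne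
      exact ht (hζT (subset_tsupport _ hne))
    obtain ⟨m, hmT, hm⟩ : ∃ m < T, ∀ t, m ≤ t → ζ t = 0 := by
      obtain ⟨m, hm⟩ := (hζs.isCompact.insert 0).exists_isGreatest (insert_nonempty _ _)
      have hmT : m < T := by
        rcases hm.1 with rfl | hm'
        · exact hT
        · exact (hζT hm').2
      refine ⟨(m + T) / 2, by linarith, fun t ht ↦ ?_⟩
      by_contra hne
      have := hm.2 (mem_insert_of_mem _ (subset_tsupport _ hne))
      linarith
    -- `Z` is the primitive of `ζ` which vanishes near `T`; multiplying it by the bump function `χ`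
    -- below makes its support compact without changing it near `[0, T]`.
    set Z : ℝ → ℝ := fun t ↦ (∫ s in (0 : ℝ)..t, ζ s) - ∫ s in (0 : ℝ)..T, ζ s with hZ
    have hZc : ContDiff ℝ 1 Z := (contDiff_primitive hζc).sub contDiff_const
    have hZm : ∀ t, m ≤ t → Z t = 0 := fun t ht ↦ by
      rw [hZ]
      simp only
      rw [intervalIntegral.integral_interval_sub_left (hζc.intervalIntegrable _ _)
        (hζc.intervalIntegrable _ _)]
      refine intervalIntegral.integral_zero_ae (Eventually.of_forall fun s hs ↦ ?_)
      exact hm s ((le_min hmT.le ht).trans hs.1.le)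
    let χ : ContDiffBump (0 : ℝ) := ⟨T + 1, T + 2, by linarith, by linarith⟩
    have hχ : ∀ t ∈ Icc 0 T, ∀ᶠ s in 𝓝 t, χ s = 1 := fun t ht ↦ by
      filter_upwards [Ioo_mem_nhds (show -1 < t by linarith [ht.1])
        (show t < T + 1 by linarith [ht.2])] with s hs
      refine χ.one_of_mem_closedBall ?_
      rw [mem_closedBall_zero_iff, Real.norm_eq_abs]
      exact abs_le.2 ⟨by change -(T + 1) ≤ s; linarith [hs.1], hs.2.le⟩
    have hη := h (fun t ↦ χ t * Z t) (χ.contDiff.mul hZc) χ.hasCompactSupport.mul_right ?_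
    · have hd : ∀ t ∈ Icc 0 T, deriv (fun t ↦ χ t * Z t) t = ζ t := fun t ht ↦ by
        have : (fun t ↦ χ t * Z t) =ᶠ[𝓝 t] Z := by
          filter_upwards [hχ t ht] with s hs using by rw [hs, one_mul]
        rw [this.deriv_eq]
        exact ((hasDerivAt_primitive hζc t).sub_const _).deriv
      have h0 : (χ 0 : ℝ) * Z 0 = -∫ s in (0 : ℝ)..T, ζ s := by
        rw [(hχ 0 ⟨le_rfl, hT.le⟩).self_of_nhds]
        simp [hZ]
      rw [h0, intervalIntegral.integral_congr (g := fun t ↦ ζ t * g t) fun t ht ↦ by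
        rw [uIcc_of_le hT.le] at ht
        simp only [hd t ht]] at hη
      have hset : ∫ t, ζ t • (g t - c) = ∫ t in (0 : ℝ)..T, ζ t * (g t - c) := by
        rw [intervalIntegral.integral_of_le hT.le]
        refine (setIntegral_eq_integral_of_forall_compl_eq_zero fun t ht ↦ ?_).symm
        rw [hζ0 t fun h ↦ ht (Ioo_subset_Ioc_self h), zero_smul]
      rw [hset]
      simp only [mul_sub]
      have hζg : ContinuousOn (fun t ↦ ζ t * g t) (Icc 0 T) := hζc.continuousOn.mul hg
      rw [intervalIntegral.integral_sub (hζg.intervalIntegrable_of_Icc hT.le)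
        ((by fun_prop : Continuous fun t ↦ ζ t * c).intervalIntegrable _ _),
        intervalIntegral.integral_mul_const]
      linarith
    · refine tsupport_mul_subset_right.trans ((closure_minimal (fun t ht ↦ ?_)
        isClosed_Iic).trans (Iic_subset_Iio.2 hmT))
      by_contra hlt
      exact ht (hZm t (not_le.1 hlt).le)
  refine Measure.eqOn_Icc_of_ae_eq volume hT.ne ?_ hg continuousOn_const
  rw [← restrict_Ioo_eq_restrict_Icc]
  rw [EventuallyEq, ae_restrict_iff' measurableSet_Ioo]
  filter_upwards [hae] with t ht hmem using sub_eq_zero.1 (ht hmem)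

/-- Weak solutions are transported along the characteristics. -/
lemma IsWeakSolution.ae_eq {T : ℝ} (hT : 0 < T) {b u₀ : ℝ → ℝ} {v : ℝ → ℝ → ℝ}
    (hb : ContinuousOn b (Icc 0 T)) (hu₀ : MemLp u₀ 2 volume) (h : IsWeakSolution T b u₀ v)
    {t : ℝ} (ht : t ∈ Icc 0 T) :
    ∀ᵐ x : ℝ, v x t = u₀ (x - ∫ s in (0 : ℝ)..t, b s) := by
  obtain ⟨b', hb'c, heq⟩ := hb.exists_continuous_eqOn_Icc hT.le
  have h' := h.congr hT.le heq
  rw [primitive_congr heq ht]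
  set A := ∫ s in (0 : ℝ)..t, b' s with hA
  have hmp := measurePreserving_add_right (volume : Measure ℝ) A
  have hae : ∀ᵐ y : ℝ, v (y + A) t = u₀ y := by
    refine ae_eq_of_integral_contDiff_smul_eq
      (((h.memLp t ht).comp_measurePreserving hmp).locallyIntegrable (by norm_num))
      (hu₀.locallyIntegrable (by norm_num)) fun ψ hψ hψs ↦ ?_
    have hψ1 : ContDiff ℝ 1 ψ := hψ.of_le (by exact_mod_cast le_top)
    have hconst := eqOn_const_of_weak_deriv hT
      (h'.continuousOn_pairing (contDiff_primitive hb'c).continuous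
        (hψ1.continuous.memLp_of_hasCompactSupport hψs))
      (fun η hη hηs hηT ↦ h'.integral_deriv_mul_pairing hb'c hψ1 hψs hη hηs hηT) t ht
    rw [← integral_sub_right_eq_self _ A]
    simpa [mul_comm] using hconst
  filter_upwards [(measurePreserving_sub_right (volume : Measure ℝ) A).quasiMeasurePreserving.ae
    hae] with x hx
  simpa using hx

/-! ### Gaussian averages of translates -/

lemma normalDensity_eq_gaussianPDFReal {v : ℝ} (hv : 0 ≤ v) (m : ℝ) :
    normalDensity m v = gaussianPDFReal m v.toNNReal := by
  ext y
  rw [normalDensity, gaussianPDFReal, Real.coe_toNNReal _ hv, one_div]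

lemma gaussianReal_le_smul_volume (m : ℝ) {v : NNReal} (hv : v ≠ 0) :
    gaussianReal m v ≤ ENNReal.ofReal (√(2 * Real.pi * v))⁻¹ • (volume : Measure ℝ) := by
  rw [gaussianReal_of_var_ne_zero m hv, ← withDensity_const]
  refine withDensity_mono (Eventually.of_forall fun y ↦ ENNReal.ofReal_le_ofReal ?_)
  rw [gaussianPDFReal]
  refine mul_le_of_le_one_right (by positivity) (Real.exp_le_one_iff.2 ?_)
  rw [neg_div]
  exact neg_nonpos.2 (by positivity)

lemma MeasureTheory.MemLp.comp_sub_left_gaussianReal {f : ℝ → ℝ} {p : ENNReal}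
    (hf : MemLp f p volume) (x m : ℝ) {v : NNReal} (hv : v ≠ 0) :
    MemLp (fun y ↦ f (x - y)) p (gaussianReal m v) :=
  (hf.comp_measurePreserving (Measure.measurePreserving_sub_left volume x)).of_measure_le_smul
    ENNReal.ofReal_ne_top (gaussianReal_le_smul_volume m hv)

lemma integrable_gaussianReal_iff {m v : ℝ} (hv : 0 < v) {f : ℝ → ℝ} :
    Integrable f (gaussianReal m v.toNNReal) ↔ Integrable (fun y ↦ f y * normalDensity m v y) := by
  rw [gaussianReal_of_var_ne_zero m (Real.toNNReal_pos.2 hv).ne',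
    integrable_withDensity_iff_integrable_smul' (measurable_gaussianPDF _ _)
      (Eventually.of_forall fun _ ↦ ENNReal.ofReal_lt_top)]
  simp_rw [toReal_gaussianPDF, normalDensity_eq_gaussianPDFReal hv.le, smul_eq_mul, mul_comm]

lemma integral_gaussianReal_eq {m v : ℝ} (hv : 0 < v) (f : ℝ → ℝ) :
    ∫ y, f y ∂gaussianReal m v.toNNReal = ∫ y, f y * normalDensity m v y := by
  rw [integral_gaussianReal_eq_integral_smul (Real.toNNReal_pos.2 hv).ne']
  simp_rw [normalDensity_eq_gaussianPDFReal hv.le, smul_eq_mul, mul_comm]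

lemma integral_mul_normalDensity_eq_convolution (f : ℝ → ℝ) (x m v : ℝ) :
    ∫ y, f (x - y) * normalDensity m v y =
      (normalDensity 0 v ⋆[ContinuousLinearMap.mul ℝ ℝ, volume] f) (x - m) := by
  rw [convolution_mul,
    ← integral_sub_right_eq_self (fun t ↦ normalDensity 0 v t * f (x - m - t)) m]
  refine integral_congr_ae (Eventually.of_forall fun y ↦ ?_)
  simp only [normalDensity, sub_zero, sub_sub_sub_cancel_right]
  ring

/-- The moments of an `L²` function composed with a translation by a Gaussian variable. The
Gaussian density is bounded, so that the translates are in `L²` of the Gaussian law, which is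
finite. -/
lemma integrable_and_integral_pow_comp_sub {Ω : Type*} [MeasurableSpace Ω] {P : Measure Ω}
    {X : Ω → ℝ} {m v : ℝ} (hv : 0 < v) (hX : HasLaw X (gaussianReal m v.toNNReal) P) {u : ℝ → ℝ}
    (hu : MemLp u 2 volume) (x : ℝ) {k : ℕ} (hk : k ≤ 2 ∨ MemLp u k volume) :
    Integrable (fun ω ↦ u (x - X ω) ^ k) P ∧
      Integrable (fun y ↦ u (x - y) ^ k * normalDensity m v y) ∧
      ∫ ω, u (x - X ω) ^ k ∂P = ∫ y, u (x - y) ^ k * normalDensity m v y := by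
  have hv' := (Real.toNNReal_pos.2 hv).ne'
  have hmem : MemLp (fun y ↦ u (x - y)) k (gaussianReal m v.toNNReal) := by
    rcases hk with hk | hk
    · exact (hu.comp_sub_left_gaussianReal x m hv').mono_exponent (by exact_mod_cast hk)
    · exact hk.comp_sub_left_gaussianReal x m hv'
  have hint : Integrable (fun y ↦ u (x - y) ^ k) (gaussianReal m v.toNNReal) := by
    rcases eq_or_ne k 0 with rfl | hk0
    · simp
    · refine (integrable_norm_iff (hmem.1.pow k)).1 ?_
      simpa using hmem.integrable_norm_pow hk0
  refine ⟨?_, (integrable_gaussianReal_iff hv).1 hint, ?_⟩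
  · rw [← hX.map_eq] at hint
    exact hint.comp_aemeasurable hX.aemeasurable
  · rw [← integral_gaussianReal_eq hv]
    exact hX.integral_comp hint.1

/-! ### Random translates -/

/-- Composition with the random translation `(x, ω) ↦ x - X ω`, which preserves null sets. -/
lemma AEMeasurable.comp_sub_prod {Ω : Type*} [MeasurableSpace Ω] {P : Measure Ω}
    [IsProbabilityMeasure P] {u : ℝ → ℝ} (hu : AEMeasurable u volume) {X : Ω → ℝ}
    (hX : AEMeasurable X P) :
    AEMeasurable (fun p : ℝ × Ω ↦ u (p.1 - X p.2)) (volume.prod P) := by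
  have hskew : MeasurePreserving (fun q : Ω × ℝ ↦ (q.1, q.2 - hX.mk X q.1))
      (P.prod volume) (P.prod volume) :=
    (MeasurePreserving.id P).skew_product
      (measurable_snd.sub (hX.measurable_mk.comp measurable_fst))
      (Eventually.of_forall fun ω ↦ (measurePreserving_sub_right volume (hX.mk X ω)).map_eq)
  have hq : Measure.QuasiMeasurePreserving (fun p : ℝ × Ω ↦ p.1 - hX.mk X p.2)
      (volume.prod P) volume :=
    (Measure.quasiMeasurePreserving_snd (μ := P) (ν := volume)).comp
      (hskew.quasiMeasurePreserving.comp
        (Measure.measurePreserving_swap (μ := volume) (ν := P)).quasiMeasurePreserving)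
  refine (hu.comp_quasiMeasurePreserving hq).congr ?_
  filter_upwards [Measure.quasiMeasurePreserving_snd.ae hX.ae_eq_mk] with p hp
  simp only [Function.comp_apply, hp]

/-- Fubini for an identity between random fields. The set where they agree is only null measurable,
so the quantifiers are exchanged for measurable representatives. -/
lemma ae_ae_eq_swap {Ω : Type*} [MeasurableSpace Ω] {P : Measure Ω} [IsProbabilityMeasure P]
    {f g : ℝ × Ω → ℝ} (hf : AEMeasurable f (volume.prod P)) (hg : AEMeasurable g (volume.prod P))
    (h : ∀ᵐ ω ∂P, ∀ᵐ x : ℝ, f (x, ω) = g (x, ω)) :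
    ∀ᵐ x : ℝ, ∀ᵐ ω ∂P, f (x, ω) = g (x, ω) := by
  have hswap := (Measure.measurePreserving_swap (μ := P) (ν := volume (α := ℝ)))
  have hae : ∀ {k : ℝ × Ω → ℝ} (hk : AEMeasurable k (volume.prod P)),
      ∀ᵐ ω ∂P, ∀ᵐ x : ℝ, k (x, ω) = hk.mk k (x, ω) := fun hk ↦
    Measure.ae_ae_of_ae_prod (hswap.quasiMeasurePreserving.ae hk.ae_eq_mk)
  have hmk : ∀ᵐ ω ∂P, ∀ᵐ x : ℝ, hf.mk f (x, ω) = hg.mk g (x, ω) := by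
    filter_upwards [h, hae hf, hae hg] with ω h1 h2 h3
    filter_upwards [h1, h2, h3] with x h1 h2 h3
    rw [← h2, ← h3, h1]
  have hmk' := (Measure.ae_ae_comm (p := fun x ω ↦ hf.mk f (x, ω) = hg.mk g (x, ω))
    (measurableSet_eq_fun hf.measurable_mk hg.measurable_mk)).2 hmk
  filter_upwards [hmk', Measure.ae_ae_of_ae_prod hf.ae_eq_mk, Measure.ae_ae_of_ae_prod hg.ae_eq_mk]
    with x h1 h2 h3
  filter_upwards [h1, h2, h3] with ω h1 h2 h3
  rw [h2, h3, h1]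

/-! ### Solution of the random transport equation -/

theorem theorem2p2 {Ω : Type*} [MeasurableSpace Ω] (P : Measure Ω) [IsProbabilityMeasure P]
    (T θ μ σ a₀ : ℝ) (hT : 0 < T) (hθ : 0 < θ) (hσ : 0 < σ)
    (B a : ℝ → Ω → ℝ) (hB : IsBrownianOn T B P) (ha : IsOrnsteinUhlenbeck T θ μ σ a₀ B a P)
    (u₀ : ℝ → ℝ) (hu₀ : MemLp u₀ 2 volume) :
    -- the integrated velocity is Gaussian, with positive variance
    (∀ t ∈ Ioc (0 : ℝ) T, 0 < ouVar θ σ t ∧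
      HasLaw (fun ω ↦ ∫ s in (0 : ℝ)..t, a s ω)
        (gaussianReal (ouMean θ μ a₀ t) (ouVar θ σ t).toNNReal) P) ∧
    -- the transported initial datum is a pathwise weak solution
    IsPathwiseWeakSolution T a u₀ (fun x t ω ↦ u₀ (x - ∫ s in (0 : ℝ)..t, a s ω)) P ∧
    -- its moments, at every point
    (∀ t ∈ Ioc (0 : ℝ) T, ∀ x : ℝ,
      (Integrable (fun ω ↦ u₀ (x - ∫ s in (0 : ℝ)..t, a s ω)) P ∧
        Integrable (fun y ↦ u₀ (x - y) * normalDensity (ouMean θ μ a₀ t) (ouVar θ σ t) y) ∧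
        ∫ ω, u₀ (x - ∫ s in (0 : ℝ)..t, a s ω) ∂P =
          ∫ y, u₀ (x - y) * normalDensity (ouMean θ μ a₀ t) (ouVar θ σ t) y ∧
        ∫ y, u₀ (x - y) * normalDensity (ouMean θ μ a₀ t) (ouVar θ σ t) y =
          (normalDensity 0 (ouVar θ σ t) ⋆[ContinuousLinearMap.mul ℝ ℝ, volume] u₀)
            (x - ouMean θ μ a₀ t)) ∧
      ∀ m : ℕ, (m ≤ 2 ∨ MemLp u₀ m volume) →
        Integrable (fun ω ↦ u₀ (x - ∫ s in (0 : ℝ)..t, a s ω) ^ m) P ∧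
        ∫ ω, u₀ (x - ∫ s in (0 : ℝ)..t, a s ω) ^ m ∂P =
          ∫ y, u₀ (x - y) ^ m * normalDensity (ouMean θ μ a₀ t) (ouVar θ σ t) y) ∧
    -- every pathwise weak solution coincides with it and has the same moments
    ∀ u : ℝ → ℝ → Ω → ℝ, IsPathwiseWeakSolution T a u₀ u P →
      (∀ᵐ ω ∂P, ∀ t ∈ Icc (0 : ℝ) T, ∀ᵐ x : ℝ,
        u x t ω = u₀ (x - ∫ s in (0 : ℝ)..t, a s ω)) ∧
      ∀ t ∈ Ioc (0 : ℝ) T, ∀ᵐ x : ℝ,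
        (Integrable (fun ω ↦ u x t ω) P ∧
          ∫ ω, u x t ω ∂P =
            ∫ y, u₀ (x - y) * normalDensity (ouMean θ μ a₀ t) (ouVar θ σ t) y ∧
          ∫ ω, u x t ω ∂P =
            (normalDensity 0 (ouVar θ σ t) ⋆[ContinuousLinearMap.mul ℝ ℝ, volume] u₀)
              (x - ouMean θ μ a₀ t)) ∧
        ∀ m : ℕ, (m ≤ 2 ∨ MemLp u₀ m volume) →
          Integrable (fun ω ↦ u x t ω ^ m) P ∧
          ∫ ω, u x t ω ^ m ∂P =
            ∫ y, u₀ (x - y) ^ m * normalDensity (ouMean θ μ a₀ t) (ouVar θ σ t) y := by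
  have hA0 : ∀ ω, ∫ s in (0 : ℝ)..0, a s ω = 0 := fun ω ↦ intervalIntegral.integral_same
  have hlaw : ∀ t ∈ Ioc (0 : ℝ) T, HasLaw (fun ω ↦ ∫ s in (0 : ℝ)..t, a s ω)
      (gaussianReal (ouMean θ μ a₀ t) (ouVar θ σ t).toNNReal) P := fun t ht ↦
    ha.hasLaw_integral hθ hB ht
  have hvar : ∀ t ∈ Ioc (0 : ℝ) T, 0 < ouVar θ σ t := fun t ht ↦ ouVar_pos hθ hσ ht.1
  have hAm : ∀ t ∈ Icc (0 : ℝ) T, AEMeasurable (fun ω ↦ ∫ s in (0 : ℝ)..t, a s ω) P := by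
    intro t ht
    rcases ht.1.eq_or_lt with rfl | h0
    · simp_rw [hA0]
      exact aemeasurable_const
    · exact (hlaw t ⟨h0, ht.2⟩).aemeasurable
  have hmeas : ∀ t ∈ Icc (0 : ℝ) T,
      AEMeasurable (fun p : ℝ × Ω ↦ u₀ (p.1 - ∫ s in (0 : ℝ)..t, a s p.2)) (volume.prod P) :=
    fun t ht ↦ hu₀.1.aemeasurable.comp_sub_prod (hAm t ht)
  have hmom : ∀ t ∈ Ioc (0 : ℝ) T, ∀ x : ℝ, ∀ m : ℕ, (m ≤ 2 ∨ MemLp u₀ m volume) → _ :=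
    fun t ht x m hm ↦ integrable_and_integral_pow_comp_sub (hvar t ht) (hlaw t ht) hu₀ x hm
  have hone : ∀ t ∈ Ioc (0 : ℝ) T, ∀ x : ℝ,
      Integrable (fun ω ↦ u₀ (x - ∫ s in (0 : ℝ)..t, a s ω)) P ∧
        Integrable (fun y ↦ u₀ (x - y) * normalDensity (ouMean θ μ a₀ t) (ouVar θ σ t) y) ∧
        ∫ ω, u₀ (x - ∫ s in (0 : ℝ)..t, a s ω) ∂P =
          ∫ y, u₀ (x - y) * normalDensity (ouMean θ μ a₀ t) (ouVar θ σ t) y := fun t ht x ↦ by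
    simpa only [pow_one] using hmom t ht x 1 (Or.inl one_le_two)
  refine ⟨fun t ht ↦ ⟨hvar t ht, hlaw t ht⟩, ⟨hmeas, ?_⟩, fun t ht x ↦ ⟨?_, ?_⟩, ?_⟩
  · filter_upwards [ha.cont] with ω hω using isWeakSolution_transport hT.le hω hu₀
  · obtain ⟨h1, h2, h3⟩ := hone t ht x
    exact ⟨h1, h2, h3, integral_mul_normalDensity_eq_convolution _ _ _ _⟩
  · intro m hm
    obtain ⟨h1, -, h3⟩ := hmom t ht x m hm
    exact ⟨h1, h3⟩
  · intro u hu
    have huniq : ∀ᵐ ω ∂P, ∀ t ∈ Icc (0 : ℝ) T, ∀ᵐ x : ℝ,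
        u x t ω = u₀ (x - ∫ s in (0 : ℝ)..t, a s ω) := by
      filter_upwards [ha.cont, hu.sol] with ω hω hsol t ht using hsol.ae_eq hT hω hu₀ ht
    refine ⟨huniq, fun t ht ↦ ?_⟩
    have ht' : t ∈ Icc 0 T := Ioc_subset_Icc_self ht
    have hxω := ae_ae_eq_swap (hu.meas t ht') (hmeas t ht') (huniq.mono fun ω h ↦ h t ht')
    filter_upwards [hxω] with x hx
    obtain ⟨h1, -, h3⟩ := hone t ht x
    refine ⟨⟨h1.congr (hx.mono fun ω h ↦ h.symm), (integral_congr_ae hx).trans h3, ?_⟩,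
      fun m hm ↦ ?_⟩
    · rw [← integral_mul_normalDensity_eq_convolution]
      exact (integral_congr_ae hx).trans h3
    · obtain ⟨h1, -, h3⟩ := hmom t ht x m hm
      have hxm : ∀ᵐ ω ∂P, u x t ω ^ m = u₀ (x - ∫ s in (0 : ℝ)..t, a s ω) ^ m :=
        hx.mono fun ω h ↦ by rw [h]
      exact ⟨h1.congr (hxm.mono fun ω h ↦ h.symm), (integral_congr_ae hxm).trans h3⟩
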